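/- Let $n\ge 2$, let $\mathbf A=(w_{ij})$ be a random real symmetric $n\times n$ matrix from the Gaussian orthogonal ensemble, i.e. the entries $w_{ij}$, $1\le i\le j\le n$, are independent with $w_{ii}\sim N(0,2)$ and $w_{ij}\sim N(0,1)$ for $i<j$, and let $\mathbf b=(b_1,\dots,b_n)$ be a random vector with independent coordinates $b_i\sim N(0,1)$. Assume that the random variables $(w_{ij})_{1\le i\le j\le n}$ and $(b_i)_{1\le i\le n}$ are all jointly independent. For $\epsilon>0$ let $$P_\epsilon=\mathbb P\bigl(|\langle \mathbf v,\mathbf b\rangle|<\epsilon \text{ for some eigenvector } \mathbf v\in\mathbb R^n \text{ of } \mathbf A \text{ with } \|\mathbf v\|_2=1\bigr)$$ be the $\epsilon$-uncontrollability of the random linear system $\frac{dx}{dt}=\mathbf A x+\mathbf b u$. Then $$\lim_{\epsilon\to 0^+}P_\epsilon=0.$$ -/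

import Mathlib

open MeasureTheory ProbabilityTheory Filter Topology

noncomputable section

/-- The index set of the entries on and above the diagonal of an `n × n` matrix. -/
abbrev UpperIndex (n : ℕ) : Type := {p : Fin n × Fin n // p.1 ≤ p.2}

/-- The random matrix `W` belongs to the Gaussian orthogonal ensemble GOE(`n`): it is (almost
surely) symmetric, its diagonal entries have law `N(0, 2)`, its entries above the diagonal have law
`N(0, 1)` (the second parameter of `gaussianReal` is the variance), and the entries on and above
the diagonal are independent. -/
structure IsGOE {Ω : Type*} [MeasurableSpace Ω] {n : ℕ}
    (W : Ω → Matrix (Fin n) (Fin n) ℝ) (μ : Measure Ω) : Prop where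
  isSymm : ∀ᵐ ω ∂μ, (W ω).IsSymm
  law_diag : ∀ i, HasLaw (fun ω => W ω i i) (gaussianReal 0 2) μ
  law_offDiag : ∀ i j, i < j → HasLaw (fun ω => W ω i j) (gaussianReal 0 1) μ
  indep : iIndepFun (fun (p : UpperIndex n) (ω : Ω) => W ω p.1.1 p.1.2) μ

/-- The coordinates of the random vector `b` are independent Gaussian variables with mean `0` and
variance `1`. -/
structure IsGaussianVector {Ω : Type*} [MeasurableSpace Ω] {n : ℕ}
    (b : Ω → EuclideanSpace ℝ (Fin n)) (μ : Measure Ω) : Prop where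
  law : ∀ i, HasLaw (fun ω => b ω i) (gaussianReal 0 1) μ
  indep : iIndepFun (fun (i : Fin n) (ω : Ω) => b ω i) μ

/-- The entries of `W` on and above the diagonal and the coordinates of `b`, taken together, form
one independent family of random variables. -/
def JointlyIndependent {Ω : Type*} [MeasurableSpace Ω] {n : ℕ}
    (W : Ω → Matrix (Fin n) (Fin n) ℝ) (b : Ω → EuclideanSpace ℝ (Fin n))
    (μ : Measure Ω) : Prop :=
  iIndepFun (fun (k : UpperIndex n ⊕ Fin n) (ω : Ω) =>
    Sum.elim (fun p : UpperIndex n => W ω p.1.1 p.1.2) (fun i : Fin n => b ω i) k) μ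

/-- The event that some real eigenvector `v` of `A` with `‖v‖₂ = 1` satisfies `|⟨v, b⟩| < ε`. -/
def uncontrollableEvent {Ω : Type*} {n : ℕ}
    (A : Ω → Matrix (Fin n) (Fin n) ℝ) (b : Ω → EuclideanSpace ℝ (Fin n)) (ε : ℝ) : Set Ω :=
  {ω | ∃ v : EuclideanSpace ℝ (Fin n),
    (∃ c : ℝ, Module.End.HasEigenvector (Matrix.toEuclideanLin (A ω)) c v) ∧
      ‖v‖ = 1 ∧ |inner ℝ v (b ω)| < ε}

/-- The `ε`-uncontrollability of the random system `dx/dt = A x + b u`. -/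
def epsUncontrollability {Ω : Type*} [MeasurableSpace Ω] {n : ℕ} (μ : Measure Ω)
    (A : Ω → Matrix (Fin n) (Fin n) ℝ) (b : Ω → EuclideanSpace ℝ (Fin n)) (ε : ℝ) : ℝ :=
  μ.real (uncontrollableEvent A b ε)

end

/-! The events shrink with `ε`, so continuity from above reduces the limit to the case `ε = 0`:
compactness of the unit sphere makes the relaxed events (`≤ ε`) closed and turns near-orthogonality
for every `ε > 0` into exact orthogonality. If a unit eigenvector `v` of a symmetric `A` satisfies
`v ⬝ᵥ b = 0`, then `v` is orthogonal to every `A ^ k b`, so the Kalman determinant vanishes. This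
determinant is a nonzero polynomial in the independent, atomless coordinates, hence almost surely
nonzero. -/

/-! ### Zero sets of polynomials are null sets -/

/-- The zero set of a nonzero real polynomial in `n` variables is null for every product of atomless
probability measures. -/
theorem MvPolynomial.ae_eval_ne_zero_fin {n : ℕ} (ν : Fin n → Measure ℝ)
    [∀ i, IsProbabilityMeasure (ν i)] (hν : ∀ i y, ν i {y} = 0)
    {p : MvPolynomial (Fin n) ℝ} (hp : p ≠ 0) :
    ∀ᵐ x ∂Measure.pi ν, MvPolynomial.eval x p ≠ 0 := by
  induction n with
  | zero =>
    refine Eventually.of_forall fun x hx => hp ?_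
    refine MvPolynomial.funext fun y => ?_
    rw [Subsingleton.elim y x, hx, map_zero]
  | succ n ih =>
    set q := MvPolynomial.finSuccEquiv ℝ n p with hq
    have hq0 : q ≠ 0 := by
      rw [hq]
      exact (map_ne_zero_iff _ (MvPolynomial.finSuccEquiv ℝ n).injective).2 hp
    -- Fubini in the variable `0`: wherever the leading coefficient in that variable does not
    -- vanish, the slice of the zero set is the finite root set of a one-variable polynomial.
    have hlead := ih (fun j => ν j.succ) (fun i y => hν i.succ y)
      (Polynomial.leadingCoeff_ne_zero.2 hq0)
    have hmp := (measurePreserving_piFinSuccAbove ν 0).symm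
    have hmeas : MeasurableSet {x : Fin (n + 1) → ℝ | MvPolynomial.eval x p = 0} :=
      (isClosed_singleton.preimage (MvPolynomial.continuous_eval p)).measurableSet
    rw [ae_iff]
    simp only [ne_eq, not_not]
    rw [← hmp.measure_preimage hmeas.nullMeasurableSet,
      Measure.prod_apply_symm (hmp.measurable hmeas)]
    refine lintegral_eq_zero_of_ae_eq_zero ?_
    filter_upwards [hlead] with s hs
    have hroots : Polynomial.map (MvPolynomial.eval s) q ≠ 0 := fun h => hs <| by
      have := congrArg (fun r => Polynomial.coeff r q.natDegree) h
      simpa [Polynomial.coeff_map] using this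
    refine measure_mono_null (t := ((Polynomial.map (MvPolynomial.eval s) q).roots.toFinset : Set ℝ))
      (fun y hy => ?_) ?_
    · have hy' : MvPolynomial.eval (Fin.cons y s : Fin (n + 1) → ℝ) p = 0 := by
        simpa [MeasurableEquiv.piFinSuccAbove, Fin.insertNthEquiv] using hy
      rw [MvPolynomial.eval_eq_eval_mv_eval'] at hy'
      simpa [hroots] using hy'
    · have : NullSingletonClass (ν 0) := ⟨hν 0⟩
      exact (Finset.finite_toSet _).measure_zero _

/-- The zero set of a nonzero real polynomial in finitely many variables is null for every product
of atomless probability measures. -/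
theorem MvPolynomial.ae_eval_ne_zero {σ : Type*} [Fintype σ] (ν : σ → Measure ℝ)
    [∀ i, IsProbabilityMeasure (ν i)] (hν : ∀ i y, ν i {y} = 0)
    {p : MvPolynomial σ ℝ} (hp : p ≠ 0) :
    ∀ᵐ x ∂Measure.pi ν, MvPolynomial.eval x p ≠ 0 := by
  let e := (Fintype.equivFin σ).symm
  have hmp := measurePreserving_piCongrLeft ν e
  have hp' : MvPolynomial.rename e.symm p ≠ 0 :=
    (map_ne_zero_iff _ (MvPolynomial.rename_injective _ e.symm.injective)).2 hp
  have h := MvPolynomial.ae_eval_ne_zero_fin (fun i => ν (e i)) (fun i y => hν (e i) y) hp'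
  rw [← hmp.map_eq]
  refine (ae_map_iff hmp.measurable.aemeasurable
    (isClosed_singleton.preimage (MvPolynomial.continuous_eval p)).measurableSet.compl).2 ?_
  filter_upwards [h] with x hx
  rw [MvPolynomial.eval_rename] at hx
  have hxe : MeasurableEquiv.piCongrLeft (fun _ => ℝ) e x = x ∘ e.symm := by
    ext i
    obtain ⟨j, rfl⟩ := e.surjective i
    simp [MeasurableEquiv.coe_piCongrLeft, Equiv.piCongrLeft_apply_apply]
  rw [hxe]
  exact hx

/-! ### The Kalman controllability matrix -/

/-- The symmetric matrix with prescribed entries on and above the diagonal. -/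
def symmOfUpper {R : Type*} {n : ℕ} (x : UpperIndex n → R) : Matrix (Fin n) (Fin n) R :=
  Matrix.of fun i j => x ⟨(min i j, max i j), min_le_max⟩

theorem isSymm_symmOfUpper {R : Type*} {n : ℕ} (x : UpperIndex n → R) :
    (symmOfUpper x).IsSymm := by
  ext i j
  simp [symmOfUpper, min_comm, max_comm]

theorem Matrix.IsSymm.symmOfUpper_eq {R : Type*} {n : ℕ} {A : Matrix (Fin n) (Fin n) R}
    (hA : A.IsSymm) : symmOfUpper (fun p : UpperIndex n => A p.1.1 p.1.2) = A := by
  ext i j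
  rcases le_total i j with h | h
  · simp [symmOfUpper, h]
  · simpa [symmOfUpper, h] using hA.apply i j

/-- The Kalman matrix, with columns `b, A b, …, A ^ (n - 1) b`. -/
def kalmanMatrix {R : Type*} [CommRing R] {n : ℕ} (A : Matrix (Fin n) (Fin n) R) (b : Fin n → R) :
    Matrix (Fin n) (Fin n) R :=
  Matrix.of fun i k => (A ^ (k : ℕ)).mulVec b i

theorem map_kalmanMatrix {R S : Type*} [CommRing R] [CommRing S] (f : R →+* S) {n : ℕ}
    (A : Matrix (Fin n) (Fin n) R) (b : Fin n → R) :
    (kalmanMatrix A b).map f = kalmanMatrix (A.map f) (f ∘ b) := by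
  ext i k
  simp only [kalmanMatrix, Matrix.map_apply, Matrix.of_apply, RingHom.map_mulVec]
  rw [← RingHom.mapMatrix_apply, map_pow, RingHom.mapMatrix_apply]

/-- The determinant of the Kalman matrix of the generic symmetric matrix and the generic vector. -/
noncomputable def genericKalmanDet (n : ℕ) : MvPolynomial (UpperIndex n ⊕ Fin n) ℝ :=
  (kalmanMatrix (symmOfUpper fun p => MvPolynomial.X (Sum.inl p))
    (fun i => MvPolynomial.X (Sum.inr i))).det

theorem eval_genericKalmanDet {n : ℕ} (x : UpperIndex n ⊕ Fin n → ℝ) :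
    MvPolynomial.eval x (genericKalmanDet n) =
      (kalmanMatrix (symmOfUpper fun p => x (Sum.inl p)) (fun i => x (Sum.inr i))).det := by
  rw [genericKalmanDet, RingHom.map_det, RingHom.mapMatrix_apply, map_kalmanMatrix]
  congr 2
  · ext i j
    simp [symmOfUpper]
  · ext i
    simp

/-- At `A = diag(0, …, n - 1)` and `b = (1, …, 1)` the Kalman matrix is Vandermonde with distinct
nodes. -/
theorem genericKalmanDet_ne_zero (n : ℕ) : genericKalmanDet n ≠ 0 := by
  intro h
  have h0 := eval_genericKalmanDet (n := n)
    (Sum.elim (fun p => if p.1.1 = p.1.2 then ((p.1.1 : ℕ) : ℝ) else 0) (fun _ => 1))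
  have hA : symmOfUpper (fun p : UpperIndex n => if p.1.1 = p.1.2 then ((p.1.1 : ℕ) : ℝ) else 0) =
      Matrix.diagonal fun i : Fin n => ((i : ℕ) : ℝ) := by
    ext i j
    by_cases hij : i = j
    · subst hij
      simp [symmOfUpper]
    · simp [symmOfUpper, hij]
  have hK : kalmanMatrix (Matrix.diagonal fun i : Fin n => ((i : ℕ) : ℝ)) (fun _ => 1) =
      Matrix.vandermonde fun i : Fin n => ((i : ℕ) : ℝ) := by
    ext i k
    simp [kalmanMatrix, Matrix.diagonal_pow, Matrix.mulVec_diagonal, Matrix.vandermonde_apply]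
  simp only [h, map_zero, Sum.elim_inl, Sum.elim_inr, hA, hK] at h0
  exact Matrix.det_vandermonde_ne_zero_iff.2
    (fun i j hij => Fin.ext (Nat.cast_injective hij)) h0.symm

/-- A left eigenvector of `A` orthogonal to `b` annihilates the Kalman matrix of `A` and `b`. -/
theorem det_kalmanMatrix_eq_zero {R : Type*} [CommRing R] [IsDomain R] {n : ℕ}
    {A : Matrix (Fin n) (Fin n) R}
    {b v : Fin n → R} {c : R} (hv : v ≠ 0) (hAv : Matrix.vecMul v A = c • v)
    (hvb : v ⬝ᵥ b = 0) : (kalmanMatrix A b).det = 0 := by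
  have hpow : ∀ k : ℕ, Matrix.vecMul v (A ^ k) = c ^ k • v := by
    intro k
    induction k with
    | zero => simp
    | succ k ih => rw [pow_succ, ← Matrix.vecMul_vecMul, ih, Matrix.smul_vecMul, hAv, smul_smul,
        pow_succ]
  refine Matrix.exists_vecMul_eq_zero_iff.1 ⟨v, hv, ?_⟩
  ext k
  change v ⬝ᵥ (A ^ (k : ℕ)).mulVec b = 0
  rw [Matrix.dotProduct_mulVec, hpow, smul_dotProduct, hvb, smul_zero]

/-! ### The closed events in coordinate space -/

/-- The coordinates of a symmetric matrix and a vector such that some unit eigenvector `v` of the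
matrix has `|⟨v, b⟩| ≤ ε`. -/
def nearlyUncontrollable (n : ℕ) (ε : ℝ) : Set (UpperIndex n ⊕ Fin n → ℝ) :=
  {x | ∃ v : EuclideanSpace ℝ (Fin n), ‖v‖ = 1 ∧
    (symmOfUpper fun p => x (Sum.inl p)).mulVec v =
      (v ⬝ᵥ (symmOfUpper fun p => x (Sum.inl p)).mulVec v) • (v : Fin n → ℝ) ∧
    |v ⬝ᵥ fun i => x (Sum.inr i)| ≤ ε}

/-- With the eigenvalue written as the Rayleigh quotient of `v`, the conditions are closed in `(x,
v)`; projecting away the compact sphere is a closed map. -/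
theorem isClosed_nearlyUncontrollable (n : ℕ) (ε : ℝ) : IsClosed (nearlyUncontrollable n ε) := by
  have hA : Continuous fun z : (UpperIndex n ⊕ Fin n → ℝ) × EuclideanSpace ℝ (Fin n) =>
      (symmOfUpper fun p => z.1 (Sum.inl p)) := by
    refine continuous_matrix fun i j => ?_
    simp only [symmOfUpper, Matrix.of_apply]
    fun_prop
  have hv : Continuous fun z : (UpperIndex n ⊕ Fin n → ℝ) × EuclideanSpace ℝ (Fin n) =>
      (z.2 : Fin n → ℝ) := by fun_prop
  have hAv := hA.matrix_mulVec hv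
  have hC : IsClosed {z : (UpperIndex n ⊕ Fin n → ℝ) × EuclideanSpace ℝ (Fin n) |
      (symmOfUpper fun p => z.1 (Sum.inl p)).mulVec z.2 =
        (z.2 ⬝ᵥ (symmOfUpper fun p => z.1 (Sum.inl p)).mulVec z.2) • (z.2 : Fin n → ℝ) ∧
      |z.2 ⬝ᵥ fun i => z.1 (Sum.inr i)| ≤ ε} := by
    have hb : Continuous fun z : (UpperIndex n ⊕ Fin n → ℝ) × EuclideanSpace ℝ (Fin n) =>
        fun i : Fin n => z.1 (Sum.inr i) := by fun_prop
    exact (isClosed_eq hAv ((hv.dotProduct hAv).smul hv)).inter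
      (isClosed_le (hv.dotProduct hb).abs continuous_const)
  have hK : IsCompact (Metric.sphere (0 : EuclideanSpace ℝ (Fin n)) 1) := isCompact_sphere 0 1
  have : CompactSpace (Metric.sphere (0 : EuclideanSpace ℝ (Fin n)) 1) :=
    isCompact_iff_compactSpace.1 hK
  have hC' := hC.preimage (f := fun z : (UpperIndex n ⊕ Fin n → ℝ) ×
    Metric.sphere (0 : EuclideanSpace ℝ (Fin n)) 1 => (z.1, (z.2 : EuclideanSpace ℝ (Fin n))))
    (by fun_prop)
  convert isClosedMap_fst_of_compactSpace _ hC' using 1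
  ext x
  constructor
  · rintro ⟨v, h1, h2, h3⟩
    exact ⟨(x, ⟨v, by simpa using h1⟩), ⟨h2, h3⟩, rfl⟩
  · rintro ⟨⟨x, v, hv⟩, ⟨h2, h3⟩, rfl⟩
    exact ⟨v, by simpa using hv, h2, h3⟩

theorem nearlyUncontrollable_mono (n : ℕ) : Monotone (nearlyUncontrollable n) :=
  fun _ _ h _ ⟨v, h1, h2, h3⟩ => ⟨v, h1, h2, h3.trans h⟩

theorem EuclideanSpace.dotProduct_self_of_norm_eq_one {n : ℕ} {v : EuclideanSpace ℝ (Fin n)}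
    (hv : ‖v‖ = 1) : (v : Fin n → ℝ) ⬝ᵥ v = 1 := by
  have h := EuclideanSpace.real_norm_sq_eq v
  rw [hv] at h
  simp only [dotProduct, ← sq]
  linarith

theorem eval_genericKalmanDet_of_mem {n : ℕ} {x : UpperIndex n ⊕ Fin n → ℝ}
    (hx : x ∈ nearlyUncontrollable n 0) : MvPolynomial.eval x (genericKalmanDet n) = 0 := by
  obtain ⟨v, h1, h2, h3⟩ := hx
  rw [eval_genericKalmanDet]
  refine det_kalmanMatrix_eq_zero (v := v)
    (c := v ⬝ᵥ (symmOfUpper fun p => x (Sum.inl p)).mulVec v) ?_ ?_ (abs_nonpos_iff.1 h3)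
  · intro h
    have := EuclideanSpace.dotProduct_self_of_norm_eq_one h1
    simp [h] at this
  -- Symmetry turns the right eigenvector into a left one.
  · rw [← Matrix.mulVec_transpose, (isSymm_symmOfUpper _).eq]
    exact h2

/-- For fixed coordinates the infimum of `|⟨v, b⟩|` over the unit eigenvectors is attained. -/
theorem iInter_nearlyUncontrollable_subset (n : ℕ) :
    ⋂ ε > (0 : ℝ), nearlyUncontrollable n ε ⊆ nearlyUncontrollable n 0 := by
  intro x hx
  simp only [Set.mem_iInter] at hx
  set M := symmOfUpper fun p => x (Sum.inl p) with hM
  have hv : Continuous fun v : EuclideanSpace ℝ (Fin n) => (v : Fin n → ℝ) := by fun_prop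
  have hMv : Continuous fun v : EuclideanSpace ℝ (Fin n) => M.mulVec v :=
    continuous_const.matrix_mulVec hv
  have hK : IsCompact (Metric.sphere (0 : EuclideanSpace ℝ (Fin n)) 1 ∩
      {v | M.mulVec v = (v ⬝ᵥ M.mulVec v) • (v : Fin n → ℝ)}) :=
    (isCompact_sphere 0 1).inter_right (isClosed_eq hMv ((hv.dotProduct hMv).smul hv))
  -- Any positive value would do: this only provides some unit eigenvector, so that the minimum is
  -- over a nonempty set.
  obtain ⟨v₁, h1, h2, -⟩ := hx 1 one_pos
  obtain ⟨v, ⟨hv1, hv2⟩, hmin⟩ := hK.exists_isMinOn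
    (f := fun v : EuclideanSpace ℝ (Fin n) => |v ⬝ᵥ fun i => x (Sum.inr i)|)
    ⟨v₁, by simpa using h1, h2⟩ (hv.dotProduct continuous_const).abs.continuousOn
  refine ⟨v, by simpa using hv1, hv2, le_of_forall_pos_le_add fun ε hε => ?_⟩
  obtain ⟨w, hw1, hw2, hw3⟩ := hx ε hε
  rw [zero_add]
  exact (isMinOn_iff.1 hmin w ⟨by simpa using hw1, hw2⟩).trans hw3

theorem tendsto_measure_nearlyUncontrollable {n : ℕ} (ν : UpperIndex n ⊕ Fin n → Measure ℝ)
    [∀ i, IsProbabilityMeasure (ν i)] (hν : ∀ i y, ν i {y} = 0) :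
    Tendsto (fun ε => Measure.pi ν (nearlyUncontrollable n ε)) (𝓝[>] 0) (𝓝 0) := by
  have h := tendsto_measure_biInter_gt (μ := Measure.pi ν) (s := nearlyUncontrollable n) (a := 0)
    (fun r _ => (isClosed_nearlyUncontrollable n r).measurableSet.nullMeasurableSet)
    (fun i j _ hij => nearlyUncontrollable_mono n hij) ⟨1, one_pos, measure_ne_top _ _⟩
  have h0 : Measure.pi ν (⋂ ε > (0 : ℝ), nearlyUncontrollable n ε) = 0 := by
    refine measure_mono_null (fun x hx => ?_)
      (ae_iff.1 (MvPolynomial.ae_eval_ne_zero ν hν (genericKalmanDet_ne_zero n)))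
    simpa using eval_genericKalmanDet_of_mem (iInter_nearlyUncontrollable_subset n hx)
  rwa [h0] at h

/-- The event of `ε`-uncontrollability, read off the coordinates of a symmetric matrix. -/
theorem mem_nearlyUncontrollable_of_mem {Ω : Type*} {n : ℕ} {A : Ω → Matrix (Fin n) (Fin n) ℝ}
    {b : Ω → EuclideanSpace ℝ (Fin n)} {ε : ℝ} {ω : Ω} (hA : (A ω).IsSymm)
    (hω : ω ∈ uncontrollableEvent A b ε) :
    Sum.elim (fun p : UpperIndex n => A ω p.1.1 p.1.2) (fun i : Fin n => b ω i) ∈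
      nearlyUncontrollable n ε := by
  obtain ⟨v, ⟨c, hc⟩, h1, h2⟩ := hω
  have hAv : (A ω).mulVec v = c • (v : Fin n → ℝ) := by
    have := congrArg (fun w : EuclideanSpace ℝ (Fin n) => (w : Fin n → ℝ)) hc.apply_eq_smul
    simpa [Matrix.toEuclideanLin] using this
  refine ⟨v, h1, ?_, ?_⟩
  · simp only [Sum.elim_inl, hA.symmOfUpper_eq]
    rw [hAv, dotProduct_smul, EuclideanSpace.dotProduct_self_of_norm_eq_one h1, smul_eq_mul,
      mul_one]
  · rw [EuclideanSpace.inner_eq_star_dotProduct, dotProduct_comm] at h2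
    simpa using h2.le

theorem corollary5p6 {Ω : Type*} [MeasurableSpace Ω] (μ : Measure Ω) [IsProbabilityMeasure μ]
    (n : ℕ) (hn : 2 ≤ n)
    (A : Ω → Matrix (Fin n) (Fin n) ℝ) (b : Ω → EuclideanSpace ℝ (Fin n))
    (hA : IsGOE A μ) (hb : IsGaussianVector b μ) (hAb : JointlyIndependent A b μ) :
    Tendsto (fun ε : ℝ => epsUncontrollability μ A b ε) (𝓝[>] 0) (𝓝 0) := by
  let X : UpperIndex n ⊕ Fin n → Ω → ℝ := fun k ω =>
    Sum.elim (fun p : UpperIndex n => A ω p.1.1 p.1.2) (fun i : Fin n => b ω i) k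
  have hX : ∀ k, ∃ s : NNReal, s ≠ 0 ∧ HasLaw (X k) (gaussianReal 0 s) μ := by
    rintro (⟨⟨i, j⟩, hij⟩ | i)
    · rcases hij.eq_or_lt with h | h
      · obtain rfl : i = j := h
        exact ⟨2, two_ne_zero, hA.law_diag i⟩
      · exact ⟨1, one_ne_zero, hA.law_offDiag i j h⟩
    · exact ⟨1, one_ne_zero, hb.law i⟩
  have hXm : ∀ k, AEMeasurable (X k) μ := fun k => (hX k).choose_spec.2.aemeasurable
  -- Joint independence makes the law of all coordinates a product measure.
  have hmap : μ.map (fun ω k => X k ω) = Measure.pi fun k => μ.map (X k) :=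
    iIndepFun.map_fun_eq_pi_map hXm hAb
  have : ∀ k, IsProbabilityMeasure (μ.map (X k)) := fun k =>
    Measure.isProbabilityMeasure_map (hXm k)
  have hatom : ∀ k y, μ.map (X k) {y} = 0 := by
    intro k y
    obtain ⟨s, hs, hlaw⟩ := hX k
    have := nullSingletonClass_gaussianReal (μ := 0) hs
    rw [hlaw.map_eq]
    exact measure_singleton y
  have hlim := tendsto_measure_nearlyUncontrollable _ hatom
  -- Only an upper bound is needed, so the original event need not be shown measurable; the closed
  -- set containing it almost surely is.
  have hle : ∀ ε, μ (uncontrollableEvent A b ε) ≤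
      (Measure.pi fun k => μ.map (X k)) (nearlyUncontrollable n ε) := by
    intro ε
    rw [← hmap, Measure.map_apply_of_aemeasurable (aemeasurable_pi_lambda _ hXm)
      (isClosed_nearlyUncontrollable n ε).measurableSet]
    refine measure_mono_ae ?_
    filter_upwards [hA.isSymm] with ω hω h
    exact mem_nearlyUncontrollable_of_mem hω h
  have hlim' := tendsto_of_tendsto_of_tendsto_of_le_of_le tendsto_const_nhds hlim
    (fun _ => zero_le) hle
  exact (ENNReal.tendsto_toReal ENNReal.zero_ne_top).comp hlim'
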